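/- **Setting.** Let $G=H_3(\mathbb R)$ be the group of real upper unitriangular $3\times3$ matrices, $\mathfrak g$ its Lie algebra of strictly upper triangular $3\times 3$ matrices, and $\Gamma=H_3(\mathbb Z)\subset G$ the lattice of matrices with integer entries. Let $P(\mathfrak g)$ be the set of lines (one-dimensional subspaces) of $\mathfrak g$; $G$ acts on it through the adjoint action, written $g\cdot\theta$. For $\theta\in P(\mathfrak g)$ put $\exp(\theta)=\{\exp v: v\in\theta\}$. Let $\theta_t$ $(t\in\mathbb R)$ be the line through $\begin{pmatrix}0&1&t\\0&0&0\\0&0&0\end{pmatrix}$ and $\theta_\infty$ the line through $\begin{pmatrix}0&0&1\\0&0&0\\0&0&0\end{pmatrix}$. Let $T=(T_\gamma)_{\gamma\in\Gamma}$ be a measure preserving action of $\Gamma$ on a $\sigma$-finite standard measure space $(X,\mathfrak B,\mu)$, and let $\mathrm{dist}$ be a right-invariant metric on $G$ compatible with its topology. - $T$ is *recurrent along* $\theta$ if for every $\varepsilon>0$ and every $A\in\mathfrak B$ with $\mu(A)>0$ there are $\gamma\in\Gamma\setminus\{1\}$ and $g\in\exp(\theta)$ with $\mathrm{dist}(\gamma,g)<\varepsilon$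 and $\mu(A\cap T_\gamma A)>0$. - $T$ is *rigid along* $\theta$ if there is a sequence $(\gamma_n)$ in $\Gamma$ with $\gamma_n\to\infty$ (it leaves every finite set), $\inf_{g\in\exp(\theta)}\mathrm{dist}(\gamma_n,g)\to0$, and $\mu(A\cap T_{\gamma_n}A)\to\mu(A)$ for every $A\in\mathfrak B$ of finite measure. - $T$ is *evenly recurrent* (respectively *evenly rigid*) *along* $\theta$ if it is recurrent (respectively rigid) along $g\cdot\theta$ for every $g\in G$. Write $\mathcal R(T)$, $\mathcal Ri(T)$, $\mathcal{ER}(T)$, $\mathcal{ER}i(T)$ for the sets of lines along which $T$ is recurrent, rigid, evenly recurrent, evenly rigid. The action $T$ is *free* if $\mu$-almost every point has trivial stabilizer. It is of *rank one* if there are a (left) Følner sequence of finite sets $F_n\subset\Gamma$ and sets $B_n\in\mathfrak B$ of finite measure such that for each $n$ the sets $T_fB_n$, $f\in F_n$, are pairwise disjoint, and for every $A\in\mathfrak B$ of finite measure there are $P_n\subset F_n$ with $\mu\bigl(A\,\triangle\,\bigcup_{f\in P_n}T_fB_n\bigr)\to0$. **Theorem.** There is a rank-one free measure preserving action $T$ of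 $H_3(\mathbb Z)$ on a $\sigma$-finite standard measure space of infinite measure such that, for every right-invariant metric on $H_3(\mathbb R)$ compatible with the topology, $$\mathcal R(T)=\mathcal Ri(T)=\{\theta_t\mid t\in\mathbb R\}\cup\{\theta_\infty\}=\mathcal{ER}(T)=\mathcal{ER}i(T).$$ In particular, this common set is uncountable. -/

import Mathlib

open Filter Topology MeasureTheory
open scoped Pointwise symmDiff LinearAlgebra.Projectivization

/-- The Heisenberg group `H₃(R)`: the triple `(x, y, z)` stands for the unitriangular matrix
with rows `(1, x, z)`, `(0, 1, y)`, `(0, 0, 1)` (see `Heisenberg.toMatrix`). -/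
@[ext]
structure Heisenberg (R : Type) where
  x : R
  y : R
  z : R

namespace Heisenberg

section Group

variable {R : Type} [CommRing R]

/-- The unitriangular matrix represented by a triple. -/
def toMatrix (g : Heisenberg R) : Matrix (Fin 3) (Fin 3) R :=
  !![1, g.x, g.z; 0, 1, g.y; 0, 0, 1]

instance : Mul (Heisenberg R) := ⟨fun g h => ⟨g.x + h.x, g.y + h.y, g.z + h.z + g.x * h.y⟩⟩
instance : One (Heisenberg R) := ⟨⟨0, 0, 0⟩⟩
instance : Inv (Heisenberg R) := ⟨fun g => ⟨-g.x, -g.y, -g.z + g.x * g.y⟩⟩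

@[simp] theorem mul_x (g h : Heisenberg R) : (g * h).x = g.x + h.x := rfl
@[simp] theorem mul_y (g h : Heisenberg R) : (g * h).y = g.y + h.y := rfl
@[simp] theorem mul_z (g h : Heisenberg R) : (g * h).z = g.z + h.z + g.x * h.y := rfl
@[simp] theorem one_x : (1 : Heisenberg R).x = 0 := rfl
@[simp] theorem one_y : (1 : Heisenberg R).y = 0 := rfl
@[simp] theorem one_z : (1 : Heisenberg R).z = 0 := rfl
@[simp] theorem inv_x (g : Heisenberg R) : g⁻¹.x = -g.x := rfl
@[simp] theorem inv_y (g : Heisenberg R) : g⁻¹.y = -g.y := rfl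
@[simp] theorem inv_z (g : Heisenberg R) : g⁻¹.z = -g.z + g.x * g.y := rfl

instance : Group (Heisenberg R) :=
  Group.ofLeftAxioms
    (by intro a b c; ext <;> simp <;> ring)
    (by intro a; ext <;> simp)
    (by intro a; ext <;> simp)

/-- The group law is matrix multiplication. -/
theorem toMatrix_mul (g h : Heisenberg R) : (g * h).toMatrix = g.toMatrix * h.toMatrix := by
  ext i j
  fin_cases i <;> fin_cases j <;> simp [toMatrix, Matrix.mul_apply, Fin.sum_univ_three] <;> ring

end Group

/-- The inclusion of the lattice `H₃(ℤ)` into `H₃(ℝ)`. -/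
def ofInt : Heisenberg ℤ →* Heisenberg ℝ where
  toFun g := ⟨g.x, g.y, g.z⟩
  map_one' := by ext <;> simp
  map_mul' g h := by ext <;> simp

/-- The lattice `H₃(ℤ)` is a discrete group. -/
instance : MeasurableSpace (Heisenberg ℤ) := ⊤

/-- The usual topology of `H₃(ℝ)`, as a subset of the space of matrices. -/
instance : TopologicalSpace (Heisenberg ℝ) := TopologicalSpace.induced toMatrix inferInstance

/-- The Lie algebra of `H₃(ℝ)`: the vector `(α, β, γ)` stands for the strictly upper triangular
matrix with rows `(0, α, γ)`, `(0, 0, β)`, `(0, 0, 0)` (see `Heisenberg.algToMatrix`). -/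
abbrev Alg : Type := ℝ × ℝ × ℝ

/-- The strictly upper triangular matrix represented by a vector. -/
def algToMatrix (v : Alg) : Matrix (Fin 3) (Fin 3) ℝ :=
  !![0, v.1, v.2.2; 0, 0, v.2.1; 0, 0, 0]

/-- The exponential map of `H₃(ℝ)`. -/
noncomputable def exp (v : Alg) : Heisenberg ℝ := ⟨v.1, v.2.1, v.2.2 + v.1 * v.2.1 / 2⟩

/-- The exponential map is the matrix exponential. -/
theorem toMatrix_exp (v : Alg) : (exp v).toMatrix = NormedSpace.exp (algToMatrix v) := by
  have h3 : algToMatrix v ^ 3 = 0 := by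
    ext i j
    fin_cases i <;> fin_cases j <;>
      simp [algToMatrix, pow_succ, Matrix.mul_apply, Fin.sum_univ_three]
  have h : ∀ n ∉ Finset.range 3,
      ((n.factorial : ℝ)⁻¹) • algToMatrix v ^ n = 0 := by
    intro n hn
    have hn' : 3 ≤ n := by simpa using hn
    rw [pow_eq_zero_of_le hn' h3, smul_zero]
  rw [NormedSpace.exp_eq_tsum ℝ]
  show _ = ∑' n : ℕ, ((n.factorial : ℝ)⁻¹) • algToMatrix v ^ n
  rw [tsum_eq_sum h]
  ext i j
  fin_cases i <;> fin_cases j <;>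
    simp [algToMatrix, toMatrix, exp, Finset.sum_range_succ, pow_succ, Nat.factorial]
  ring

/-- The adjoint action of `H₃(ℝ)` on its Lie algebra. -/
def Ad (g : Heisenberg ℝ) : Alg →ₗ[ℝ] Alg where
  toFun v := (v.1, v.2.1, v.2.2 + g.x * v.2.1 - g.y * v.1)
  map_add' v w := by
    ext <;> simp
    ring
  map_smul' c v := by
    ext <;> simp
    ring

/-- The adjoint action is conjugation of matrices. -/
theorem algToMatrix_Ad (g : Heisenberg ℝ) (v : Alg) :
    algToMatrix (Ad g v) = g.toMatrix * algToMatrix v * g⁻¹.toMatrix := by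
  ext i j
  fin_cases i <;> fin_cases j <;>
    simp [algToMatrix, toMatrix, Ad, Matrix.mul_apply, Fin.sum_univ_three] <;> ring

theorem Ad_injective (g : Heisenberg ℝ) : Function.Injective (Ad g) := by
  rintro ⟨a, b, c⟩ ⟨a', b', c'⟩ h
  simp only [Ad, LinearMap.coe_mk, AddHom.coe_mk, Prod.mk.injEq] at h
  obtain ⟨rfl, rfl, h⟩ := h
  simpa using h

/-- The directions: lines through `0` in the Lie algebra. -/
abbrev Direction : Type := ℙ ℝ Alg

/-- The action `g · θ` of `H₃(ℝ)` on directions induced by the adjoint action. -/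
noncomputable def actOn (g : Heisenberg ℝ) (θ : Direction) : Direction :=
  Projectivization.map (Ad g) (Ad_injective g) θ

/-- The one-parameter subgroup `exp(θ)`. -/
def expLine (θ : Direction) : Set (Heisenberg ℝ) := exp '' (θ.submodule : Set Alg)

/-- The direction `θ_t`, spanned by `(1, 0, t)`. -/
noncomputable def dir (t : ℝ) : Direction :=
  Projectivization.mk ℝ ((1, 0, t) : Alg) (by simp)

/-- The direction `θ_∞`, spanned by `(0, 0, 1)`. -/
noncomputable def dirInf : Direction :=
  Projectivization.mk ℝ ((0, 0, 1) : Alg) (by simp)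

/-- A right-invariant metric on `H₃(ℝ)` compatible with the topology. -/
structure RightInvariantMetric where
  toMetricSpace : MetricSpace (Heisenberg ℝ)
  compatible : toMetricSpace.toPseudoMetricSpace.toUniformSpace.toTopologicalSpace =
    (inferInstance : TopologicalSpace (Heisenberg ℝ))
  dist_mul_right : ∀ g h k : Heisenberg ℝ,
    toMetricSpace.dist (g * k) (h * k) = toMetricSpace.dist g h

/-- The distance between two points for a given right-invariant metric. -/
def RightInvariantMetric.d (m : RightInvariantMetric) (g h : Heisenberg ℝ) : ℝ :=
  m.toMetricSpace.dist g h

section Actions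

variable (m : RightInvariantMetric) {X : Type} [MeasurableSpace X] [MulAction (Heisenberg ℤ) X]
  (μ : Measure X)

/-- The action is recurrent along the direction `θ`. -/
def RecurrentAlong (θ : Direction) : Prop :=
  ∀ ε : ℝ, 0 < ε → ∀ A : Set X, MeasurableSet A → 0 < μ A →
    ∃ γ : Heisenberg ℤ, γ ≠ 1 ∧ ∃ g ∈ expLine θ, m.d (ofInt γ) g < ε ∧ 0 < μ (A ∩ γ • A)

/-- The action is evenly recurrent along `θ`: recurrent along the whole `H₃(ℝ)`-orbit of `θ`. -/
def EvenlyRecurrentAlong (θ : Direction) : Prop :=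
  ∀ g : Heisenberg ℝ, RecurrentAlong m μ (actOn g θ)

/-- The action is rigid along the direction `θ`: for some sequence `γₙ → ∞` in `H₃(ℤ)`, i.e.
leaving every finite set, `dist(γₙ, exp θ) → 0` and the maps `γₙ` converge weakly to the
identity. -/
def RigidAlong (θ : Direction) : Prop :=
  ∃ γ : ℕ → Heisenberg ℤ, Tendsto γ atTop cofinite ∧
    Tendsto (fun n => ⨅ g : expLine θ, m.d (ofInt (γ n)) g) atTop (𝓝 0) ∧
    ∀ A : Set X, MeasurableSet A → μ A < ⊤ →
      Tendsto (fun n => μ (A ∩ γ n • A)) atTop (𝓝 (μ A))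

/-- The action is evenly rigid along `θ`: rigid along the whole `H₃(ℝ)`-orbit of `θ`. -/
def EvenlyRigidAlong (θ : Direction) : Prop :=
  ∀ g : Heisenberg ℝ, RigidAlong m μ (actOn g θ)

end Actions

end Heisenberg

/-- A measure preserving action is free: almost every point has trivial stabilizer. -/
def FreeAction (Γ : Type) [Group Γ] {X : Type} [MeasurableSpace X] [MulAction Γ X]
    (μ : Measure X) : Prop :=
  ∀ᵐ x ∂μ, ∀ γ : Γ, γ • x = x → γ = 1

/-- A measure preserving action of a discrete group `Γ` has rank one: there are a Følner sequence
of finite sets `Fₙ` in `Γ` and sets `Bₙ` of finite measure such that the translates `f • Bₙ`,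
`f ∈ Fₙ`, are pairwise disjoint (the `n`-th Rokhlin tower) and every set of finite measure is
approximated by unions of levels of the `n`-th tower as `n → ∞`. -/
def RankOneAction (Γ : Type) [Group Γ] [MeasurableSpace Γ] {X : Type} [MeasurableSpace X]
    [MulAction Γ X] (μ : Measure X) : Prop :=
  ∃ (F : ℕ → Finset Γ) (B : ℕ → Set X),
    IsFoelner Γ (Measure.count : Measure Γ) atTop (fun n => (F n : Set Γ)) ∧
    (∀ n, MeasurableSet (B n) ∧ μ (B n) < ⊤) ∧
    (∀ n, (F n : Set Γ).PairwiseDisjoint (fun f => f • B n)) ∧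
    ∀ A : Set X, MeasurableSet A → μ A < ⊤ →
      ∃ P : ℕ → Finset Γ, (∀ n, P n ⊆ F n) ∧
        Tendsto (fun n => μ (A ∆ ⋃ f ∈ P n, f • B n)) atTop (𝓝 0)

/-!
Complete `H₃(ℤ)` `p`-adically in the entries `x` and `z` only. The resulting group `G` of
unitriangular matrices with `x, z ∈ ℤₚ` and `y ∈ ℤ` is locally compact, not compact, and contains
`H₃(ℤ)` as a dense subgroup; the action is left translation on `G` with its Haar measure.

It is free because the embedding is injective. It has rank one because the integer points of
`[0, pⁿ) × [-n, n] × [0, pⁿ)` form a Følner sequence and translate the compact set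
`pⁿℤₚ × {0} × pⁿℤₚ` to disjoint sets of diameter at most `p⁻ⁿ` that exhaust `G`.

If `γₙ → 1` in `G`, then the translations by `γₙ` converge weakly to the identity. The elements
`(pⁿ k, 0, pⁿ j)` have this property, and Dirichlet approximation chooses `j / k` so close to `t`
that they approach `exp θ_t`. Conversely, the open set `{y = 0}` meets its translate by `γ` only if
`γ` has `y = 0`, and a lattice point `γ ≠ 1` with `y = 0` stays away from `exp θ` whenever `θ`
contains a vector with `β ≠ 0`.
-/

section MeasureApproximation

variable {X ι α : Type*} {l : Filter ι}

theorem tendsto_measure_inter_of_tendsto_measure_symmDiff [MeasurableSpace X] {μ : Measure X}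
    {A : Set X} {s : ι → Set X} (hA : μ A ≠ ⊤) (hs : Tendsto (fun i => μ (s i ∆ A)) l (𝓝 0)) :
    Tendsto (fun i => μ (A ∩ s i)) l (𝓝 (μ A)) := by
  have lower : Tendsto (fun i => μ A - μ (s i ∆ A)) l (𝓝 (μ A)) := by
    simpa using ENNReal.Tendsto.sub (tendsto_const_nhds (x := μ A)) hs (Or.inl hA)
  refine tendsto_of_tendsto_of_tendsto_of_le_of_le lower tendsto_const_nhds (fun i => ?_)
    (fun i => measure_mono Set.inter_subset_left)
  refine tsub_le_iff_right.2 ((measure_le_inter_add_sdiff μ A (s i)).trans ?_)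
  gcongr
  exact Set.subset_union_right

theorem tendsto_measure_inter_smul {G : Type*} [TopologicalSpace G] [Group G]
    [IsTopologicalGroup G] [MeasurableSpace G] [BorelSpace G] (μ : Measure G)
    [μ.IsMulLeftInvariant] [IsLocallyFiniteMeasure μ] [μ.InnerRegularCompactLTTop] {g : ι → G}
    (hg : Tendsto g l (𝓝 1)) {A : Set G} (hA : MeasurableSet A) (hfin : μ A ≠ ⊤) :
    Tendsto (fun i => μ (A ∩ g i • A)) l (𝓝 (μ A)) := by
  let translation : C(G, C(G, G)) := ContinuousMap.curry ⟨fun p => p.1 * p.2, continuous_mul⟩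
  have hmp (a : G) : MeasurePreserving (translation a) μ μ := measurePreserving_mul_left μ a
  have hlim : Tendsto (fun i => translation (g i)⁻¹) l (𝓝 (translation 1)) :=
    (translation.continuous.tendsto 1).comp (by simpa using hg.inv)
  have hsymm := tendsto_measure_symmDiff_preimage_nhds_zero hlim (.of_forall fun _ => hmp _)
    (hmp 1) hA.nullMeasurableSet hfin
  have preimage_one : translation 1 ⁻¹' A = A := by
    ext x
    simp [translation]
  have preimage_inv (a : G) : translation a⁻¹ ⁻¹' A = a • A := by
    ext x
    simp [translation, Set.mem_smul_set_iff_inv_smul_mem]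
  simp only [preimage_one, preimage_inv] at hsymm
  exact tendsto_measure_inter_of_tendsto_measure_symmDiff hfin hsymm

open Classical in
theorem eventually_exists_subset_biUnion_subset [PseudoMetricSpace X]
    {F : ι → Finset α} {L : ι → α → Set X} {r : ι → ℝ} (hr : Tendsto r l (𝓝 0))
    (hL : ∀ i, ∀ a ∈ F i, ∀ x ∈ L i a, ∀ y ∈ L i a, dist x y ≤ r i) {K U : Set X}
    (hK : IsCompact K) (hU : IsOpen U) (hKU : K ⊆ U) (hcover : ∀ᶠ i in l, K ⊆ ⋃ a ∈ F i, L i a) :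
    ∀ᶠ i in l, ∃ P ⊆ F i, K ⊆ ⋃ a ∈ P, L i a ∧ ⋃ a ∈ P, L i a ⊆ U := by
  obtain ⟨δ, hδ, hthick⟩ := hK.exists_thickening_subset_open hU hKU
  filter_upwards [hr.eventually_lt_const hδ, hcover] with i hi hKi
  refine ⟨{a ∈ F i | (L i a ∩ K).Nonempty}, Finset.filter_subset _ _, fun x hx => ?_,
    Set.iUnion₂_subset fun a ha y hy => hthick ?_⟩
  · obtain ⟨a, ha, hxa⟩ := Set.mem_iUnion₂.1 (hKi hx)
    exact Set.mem_biUnion (Finset.mem_coe.2 (Finset.mem_filter.2 ⟨ha, x, hxa, hx⟩)) hxa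
  · obtain ⟨haF, x, hxa, hxK⟩ := Finset.mem_filter.1 ha
    exact Metric.mem_thickening_iff.2 ⟨x, hxK, (hL i a haF y hy x hxa).trans_lt hi⟩

theorem exists_tendsto_measure_symmDiff_biUnion [TopologicalSpace X] [T2Space X]
    [MeasurableSpace X] [OpensMeasurableSpace X] {μ : Measure X} [μ.OuterRegular]
    [μ.InnerRegularCompactLTTop] {F : ι → Finset α} {L : ι → α → Set X}
    (hL : ∀ K U : Set X, IsCompact K → IsOpen U → K ⊆ U →
      ∀ᶠ i in l, ∃ P ⊆ F i, K ⊆ ⋃ a ∈ P, L i a ∧ ⋃ a ∈ P, L i a ⊆ U)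
    {A : Set X} (hA : MeasurableSet A) (hfin : μ A ≠ ⊤) :
    ∃ P : ι → Finset α, (∀ i, P i ⊆ F i) ∧
      Tendsto (fun i => μ (A ∆ ⋃ a ∈ P i, L i a)) l (𝓝 0) := by
  choose P hPF hPmin using fun i => (F i).powerset.exists_min_image
    (fun P => μ (A ∆ ⋃ a ∈ P, L i a)) ⟨∅, Finset.empty_mem_powerset _⟩
  refine ⟨P, fun i => Finset.mem_powerset.1 (hPF i), ENNReal.tendsto_nhds_zero.2 fun ε hε => ?_⟩
  obtain ⟨K, hKA, hK, hKμ⟩ := hA.exists_isCompact_sdiff_lt hfin (ENNReal.half_pos hε.ne').ne'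
  obtain ⟨U, hAU, hU, -, hUμ⟩ := hA.exists_isOpen_sdiff_lt hfin (ENNReal.half_pos hε.ne').ne'
  filter_upwards [hL K U hK hU (hKA.trans hAU)] with i ⟨Q, hQF, hKQ, hQU⟩
  calc μ (A ∆ ⋃ a ∈ P i, L i a)
      ≤ μ (A ∆ ⋃ a ∈ Q, L i a) := hPmin i Q (Finset.mem_powerset.2 hQF)
    _ ≤ μ (A \ K ∪ U \ A) := measure_mono <| Set.union_subset_union
        (Set.sdiff_subset_sdiff_right hKQ) (Set.sdiff_subset_sdiff_left hQU)
    _ ≤ μ (A \ K) + μ (U \ A) := measure_union_le _ _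
    _ ≤ ε / 2 + ε / 2 := add_le_add hKμ.le hUμ.le
    _ = ε := ENNReal.add_halves ε

end MeasureApproximation

theorem exists_int_seq_tendsto_natCast_mul_sub (t : ℝ) (q : ℕ → ℕ) :
    ∃ j k : ℕ → ℤ, (∀ n, 0 < k n) ∧
      Tendsto (fun n => (q n : ℝ) * (j n - k n * t)) atTop (𝓝 0) := by
  choose j k hk _ hjk using fun n =>
    Real.exists_int_int_abs_mul_sub_le t (n := (n + 1) * (q n + 1)) (by positivity)
  refine ⟨j, k, hk, squeeze_zero_norm (fun n => ?_) tendsto_one_div_add_atTop_nhds_zero_nat⟩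
  calc ‖(q n : ℝ) * (j n - k n * t)‖
      = q n * |k n * t - j n| := by
        rw [norm_mul, Real.norm_natCast, Real.norm_eq_abs, abs_sub_comm]
    _ ≤ q n * (1 / (((n + 1) * (q n + 1) : ℕ) + 1)) := by gcongr; exact hjk n
    _ ≤ 1 / (n + 1) := by
        rw [mul_one_div, div_le_div_iff₀ (by positivity) (by positivity)]
        push_cast
        nlinarith

section Foelner

variable {G ι : Type*} [Group G] {l : Filter ι}

open scoped Finset

open Classical in
theorem card_smul_symmDiff (g : G) (F : Finset G) :
    #((g • F) ∆ F) = 2 * #{f ∈ F | g * f ∉ F} := by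
  have hsdiff : #(g • F \ F) = #{f ∈ F | g * f ∉ F} := by
    rw [← Finset.card_smul_finset g {f ∈ F | g * f ∉ F}]
    congr 1
    ext f
    simp [← Finset.inv_smul_mem_iff]
  have hcomm : #(F \ g • F) = #(g • F \ F) :=
    Finset.card_sdiff_comm (Finset.card_smul_finset g F).symm
  rw [symmDiff_def, Finset.sup_eq_union, Finset.card_union_of_disjoint disjoint_sdiff_sdiff, hcomm,
    hsdiff, two_mul]

open Classical in
theorem isFoelner_count_of_tendsto [MeasurableSpace G] [MeasurableSingletonClass G]
    {F : ι → Finset G} (hF : ∀ᶠ i in l, (F i).Nonempty)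
    (h : ∀ g : G, Tendsto (fun i => (#{f ∈ F i | g * f ∉ F i} : ℝ) / #(F i)) l (𝓝 0)) :
    IsFoelner G (Measure.count : Measure G) l (fun i => (F i : Set G)) where
  eventually_measurableSet := .of_forall fun i => (F i).measurableSet
  eventually_meas_ne_zero := hF.mono fun i hi => by
    simpa [Measure.count_apply_finset] using hi.ne_empty
  eventually_meas_ne_top := .of_forall fun i => by simp [Measure.count_apply_finset]
  tendsto_meas_smul_symmDiff g := by
    have hlim := ENNReal.tendsto_ofReal ((h g).const_mul 2)
    rw [mul_zero, ENNReal.ofReal_zero] at hlim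
    refine hlim.congr' (hF.mono fun i hi => ?_)
    have hpos : (0 : ℝ) < #(F i) := by exact_mod_cast hi.card_pos
    beta_reduce
    rw [← Finset.coe_smul_finset, ← Finset.coe_symmDiff, Measure.count_apply_finset,
      Measure.count_apply_finset, card_smul_symmDiff, ← mul_div_assoc,
      ENNReal.ofReal_div_of_pos hpos, ENNReal.ofReal_natCast, ← Nat.cast_ofNat, ← Nat.cast_mul,
      ENNReal.ofReal_natCast]

end Foelner

namespace Heisenberg

section Boxes

open scoped Finset

instance : DiscreteMeasurableSpace (Heisenberg ℤ) := ⟨fun _ => trivial⟩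

/-- The coordinates of an element of `H₃(R)`. -/
def equivProd (R : Type) : Heisenberg R ≃ R × R × R where
  toFun g := (g.x, g.y, g.z)
  invFun p := ⟨p.1, p.2.1, p.2.2⟩

/-- The elements of `H₃(R)` with entries in prescribed finite sets, the shape of the Følner sets. -/
def box {R : Type} (s t u : Finset R) : Finset (Heisenberg R) :=
  (s ×ˢ t ×ˢ u).map (equivProd R).symm.toEmbedding

theorem mem_box {R : Type} {s t u : Finset R} {g : Heisenberg R} :
    g ∈ box s t u ↔ g.x ∈ s ∧ g.y ∈ t ∧ g.z ∈ u := by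
  simp only [box, Finset.mem_map_equiv, Equiv.symm_symm, Finset.mem_product]
  rfl

theorem card_box {R : Type} (s t u : Finset R) : #(box s t u) = #s * (#t * #u) := by
  simp [box]

open Classical in
/-- The `m`-boundary of a set of integers: its elements that some translation by at most `m` moves
out of it. -/
noncomputable def boundary (s : Finset ℤ) (m : ℕ) : Finset ℤ :=
  {k ∈ s | ∃ a : ℤ, |a| ≤ m ∧ a + k ∉ s}

theorem mem_boundary {s : Finset ℤ} {m : ℕ} {k : ℤ} :
    k ∈ boundary s m ↔ k ∈ s ∧ ∃ a : ℤ, |a| ≤ m ∧ a + k ∉ s := by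
  simp [boundary]

theorem card_boundary_Ico_le (lo hi : ℤ) (m : ℕ) : #(boundary (Finset.Ico lo hi) m) ≤ 2 * m := by
  have hsub : boundary (Finset.Ico lo hi) m ⊆ Finset.Ico lo (lo + m) ∪ Finset.Ico (hi - m) hi := by
    intro k hk
    obtain ⟨hks, a, ha, hak⟩ := mem_boundary.1 hk
    rw [abs_le] at ha
    simp only [Finset.mem_union, Finset.mem_Ico] at hks hak ⊢
    omega
  calc #(boundary (Finset.Ico lo hi) m)
      ≤ #(Finset.Ico lo (lo + m)) + #(Finset.Ico (hi - m) hi) :=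
        (Finset.card_le_card hsub).trans (Finset.card_union_le _ _)
    _ = 2 * m := by simp only [Int.card_Ico]; omega

open Classical in
theorem card_filter_mul_notMem_box_le (g : Heisenberg ℤ) {s t u : Finset ℤ} {b : ℕ}
    (ht : ∀ y ∈ t, |y| ≤ b) :
    #{f ∈ box s t u | g * f ∉ box s t u} ≤
      #(boundary s g.x.natAbs) * (#t * #u) + #s * (#(boundary t g.y.natAbs) * #u) +
        #s * (#t * #(boundary u (g.z.natAbs + g.x.natAbs * b))) := by
  have hsub : {f ∈ box s t u | g * f ∉ box s t u} ⊆
      box (boundary s g.x.natAbs) t u ∪ box s (boundary t g.y.natAbs) u ∪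
        box s t (boundary u (g.z.natAbs + g.x.natAbs * b)) := by
    intro f hf
    simp only [Finset.mem_filter, Finset.mem_union, mem_box, mul_x, mul_y, mul_z] at hf ⊢
    obtain ⟨⟨hx, hy, hz⟩, hgf⟩ := hf
    by_cases hgx : g.x + f.x ∈ s
    · by_cases hgy : g.y + f.y ∈ t
      · refine Or.inr ⟨hx, hy, mem_boundary.2 ⟨hz, g.z + g.x * f.y, ?_, fun hgz => ?_⟩⟩
        · calc |g.z + g.x * f.y| ≤ |g.z| + |g.x| * |f.y| := by
                rw [← abs_mul]; exact abs_add_le _ _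
            _ ≤ |g.z| + |g.x| * b := by gcongr; exact ht _ hy
            _ = _ := by push_cast; rfl
        · exact hgf ⟨hgx, hgy, by rwa [add_right_comm] at hgz⟩
      · exact Or.inl (Or.inr ⟨hx, mem_boundary.2 ⟨hy, g.y, by simp, hgy⟩, hz⟩)
    · exact Or.inl (Or.inl ⟨mem_boundary.2 ⟨hx, g.x, by simp, hgx⟩, hy, hz⟩)
  calc _ ≤ _ := Finset.card_le_card hsub
    _ ≤ _ := (Finset.card_union_le _ _).trans (Nat.add_le_add_right (Finset.card_union_le _ _) _)
    _ = _ := by simp only [card_box]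

/-- The integer points of `[0, a) × [-b, b] × [0, a)`. -/
noncomputable def intervalBox (a b : ℕ) : Finset (Heisenberg ℤ) :=
  box (Finset.Ico 0 a) (Finset.Ico (-b) (b + 1)) (Finset.Ico 0 a)

theorem mem_intervalBox {a b : ℕ} {g : Heisenberg ℤ} :
    g ∈ intervalBox a b ↔ (0 ≤ g.x ∧ g.x < a) ∧ |g.y| ≤ b ∧ (0 ≤ g.z ∧ g.z < a) := by
  simp only [intervalBox, mem_box, Finset.mem_Ico, abs_le, Int.lt_add_one_iff]

theorem card_Ico_neg (b : ℕ) : #(Finset.Ico (-b : ℤ) (b + 1)) = 2 * b + 1 := by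
  rw [Int.card_Ico]
  omega

theorem card_intervalBox (a b : ℕ) : #(intervalBox a b) = a * ((2 * b + 1) * a) := by
  rw [intervalBox, card_box, card_Ico_neg]
  simp

open Classical in
theorem card_filter_mul_notMem_intervalBox_div_le (g : Heisenberg ℤ) {a : ℕ} (ha : 0 < a) (b : ℕ) :
    (#{f ∈ intervalBox a b | g * f ∉ intervalBox a b} : ℝ) / #(intervalBox a b) ≤
      2 * g.x.natAbs * (a : ℝ)⁻¹ + 2 * g.y.natAbs * (2 * b + 1 : ℝ)⁻¹ +
        (2 * g.z.natAbs * (a : ℝ)⁻¹ + 2 * g.x.natAbs * (b / a : ℝ)) := by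
  have hcard : #{f ∈ intervalBox a b | g * f ∉ intervalBox a b} ≤
      2 * g.x.natAbs * ((2 * b + 1) * a) + a * (2 * g.y.natAbs * a) +
        a * ((2 * b + 1) * (2 * (g.z.natAbs + g.x.natAbs * b))) := by
    refine (card_filter_mul_notMem_box_le g (b := b) fun y hy => ?_).trans ?_
    · rw [Finset.mem_Ico] at hy
      exact abs_le.2 ⟨hy.1, Int.lt_add_one_iff.1 hy.2⟩
    · have hIco : #(Finset.Ico (0 : ℤ) a) = a := by simp
      rw [card_Ico_neg, hIco]
      gcongr <;> exact card_boundary_Ico_le _ _ _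
  rw [card_intervalBox, div_le_iff₀ (by positivity)]
  refine (Nat.cast_le.2 hcard).trans_eq ?_
  push_cast
  field_simp

theorem isFoelner_intervalBox {ι : Type*} {l : Filter ι} {a b : ι → ℕ} (ha : Tendsto a l atTop)
    (hb : Tendsto b l atTop) (hba : Tendsto (fun i => (b i / a i : ℝ)) l (𝓝 0)) :
    IsFoelner (Heisenberg ℤ) (Measure.count : Measure (Heisenberg ℤ)) l
      (fun i => (intervalBox (a i) (b i) : Set (Heisenberg ℤ))) := by
  classical
  have hpos : ∀ᶠ i in l, 0 < a i := ha.eventually_gt_atTop 0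
  refine isFoelner_count_of_tendsto (hpos.mono fun i hi => ?_) fun g => ?_
  · rw [← Finset.card_pos, card_intervalBox]
    positivity
  have ha' : Tendsto (fun i => (a i : ℝ)⁻¹) l (𝓝 0) :=
    (tendsto_natCast_atTop_atTop.comp ha).inv_tendsto_atTop
  have hb' : Tendsto (fun i => (2 * b i + 1 : ℝ)⁻¹) l (𝓝 0) :=
    (tendsto_atTop_add_const_right _ _
      ((tendsto_natCast_atTop_atTop.comp hb).const_mul_atTop two_pos)).inv_tendsto_atTop
  refine squeeze_zero' (.of_forall fun i => by positivity)
    (hpos.mono fun i hi => card_filter_mul_notMem_intervalBox_div_le g hi (b i)) ?_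
  simpa using ((ha'.const_mul (2 * g.x.natAbs : ℝ)).add (hb'.const_mul (2 * g.y.natAbs : ℝ))).add
    ((ha'.const_mul (2 * g.z.natAbs : ℝ)).add (hba.const_mul (2 * g.x.natAbs : ℝ)))

end Boxes

@[simp] theorem ofInt_x (g : Heisenberg ℤ) : (ofInt g).x = g.x := rfl
@[simp] theorem ofInt_y (g : Heisenberg ℤ) : (ofInt g).y = g.y := rfl
@[simp] theorem ofInt_z (g : Heisenberg ℤ) : (ofInt g).z = g.z := rfl

section Topology

@[fun_prop]
theorem continuous_mk {Y : Type*} [TopologicalSpace Y] {a b c : Y → ℝ} (ha : Continuous a)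
    (hb : Continuous b) (hc : Continuous c) :
    Continuous (fun y => (⟨a y, b y, c y⟩ : Heisenberg ℝ)) := by
  refine continuous_induced_rng.2 (continuous_matrix fun i j => ?_)
  fin_cases i <;> fin_cases j <;> simp [toMatrix, continuous_const, ha, hb, hc]

theorem continuous_toMatrix_apply (i j : Fin 3) :
    Continuous fun g : Heisenberg ℝ => g.toMatrix i j :=
  continuous_induced_dom.matrix_elem i j

@[fun_prop]
theorem continuous_x : Continuous (x : Heisenberg ℝ → ℝ) := continuous_toMatrix_apply 0 1

@[fun_prop]
theorem continuous_y : Continuous (y : Heisenberg ℝ → ℝ) := continuous_toMatrix_apply 1 2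

@[fun_prop]
theorem continuous_z : Continuous (z : Heisenberg ℝ → ℝ) := continuous_toMatrix_apply 0 2

@[fun_prop]
theorem continuous_exp : Continuous exp := by
  unfold exp
  fun_prop

instance : ContinuousMul (Heisenberg ℝ) :=
  ⟨by change Continuous fun p : Heisenberg ℝ × Heisenberg ℝ =>
        (⟨p.1.x + p.2.x, p.1.y + p.2.y, p.1.z + p.2.z + p.1.x * p.2.y⟩ : Heisenberg ℝ)
      fun_prop⟩

theorem exp_zero : exp 0 = 1 := by
  ext <;> simp [exp]

theorem eventually_forall_ofInt_eq_imp_eq_one :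
    ∀ᶠ g in 𝓝 (1 : Heisenberg ℝ), ∀ γ : Heisenberg ℤ, ofInt γ = g → γ = 1 := by
  have small {f : Heisenberg ℝ → ℝ} (hf : Continuous f) (hf1 : f 1 = 0) :
      ∀ᶠ g in 𝓝 (1 : Heisenberg ℝ), |f g| < 1 :=
    hf.abs.continuousAt.eventually_lt_const (by simp [hf1])
  filter_upwards [small continuous_x one_x, small continuous_y one_y, small continuous_z one_z]
    with g hx hy hz
  rintro γ rfl
  rw [ofInt_x, ← Int.cast_abs] at hx
  rw [ofInt_y, ← Int.cast_abs] at hy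
  rw [ofInt_z, ← Int.cast_abs] at hz
  exact Heisenberg.ext (Int.abs_lt_one_iff.1 (by exact_mod_cast hx))
    (Int.abs_lt_one_iff.1 (by exact_mod_cast hy)) (Int.abs_lt_one_iff.1 (by exact_mod_cast hz))

end Topology

namespace RightInvariantMetric

variable (m : RightInvariantMetric)

theorem d_nonneg (g h : Heisenberg ℝ) : 0 ≤ m.d g h :=
  @dist_nonneg _ m.toMetricSpace.toPseudoMetricSpace g h

theorem d_eq_d_mul_inv_one (g h : Heisenberg ℝ) : m.d g h = m.d (g * h⁻¹) 1 := by
  rw [d, d, ← m.dist_mul_right g h h⁻¹, mul_inv_cancel]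

theorem nhds_eq (g : Heisenberg ℝ) :
    @nhds (Heisenberg ℝ) m.toMetricSpace.toPseudoMetricSpace.toUniformSpace.toTopologicalSpace g =
      𝓝 g := by
  rw [m.compatible]

theorem tendsto_d_zero {ι : Type*} {l : Filter ι} {g h : ι → Heisenberg ℝ}
    (hgh : Tendsto (fun i => g i * (h i)⁻¹) l (𝓝 1)) :
    Tendsto (fun i => m.d (g i) (h i)) l (𝓝 0) := by
  simp only [m.d_eq_d_mul_inv_one (g _)]
  rw [← m.nhds_eq] at hgh
  let _ := m.toMetricSpace
  exact tendsto_iff_dist_tendsto_zero.1 hgh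

theorem exists_forall_d_lt_imp {p : Heisenberg ℝ → Prop} (hp : ∀ᶠ g in 𝓝 1, p g) :
    ∃ ε > 0, ∀ g h, m.d g h < ε → p (g * h⁻¹) := by
  rw [← m.nhds_eq] at hp
  let _ := m.toMetricSpace
  obtain ⟨ε, hε, hball⟩ := Metric.eventually_nhds_iff.1 hp
  exact ⟨ε, hε, fun g h hgh => hball (by rwa [m.d_eq_d_mul_inv_one] at hgh)⟩

end RightInvariantMetric

section Directions

/-- The directions spanned by vectors of the abelian ideal `{(α, 0, γ)}`. -/
abbrev idealDirections : Set Direction := Set.range dir ∪ {dirInf}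

theorem mk_mem_idealDirections_iff {v : Alg} (hv : v ≠ 0) :
    Projectivization.mk ℝ v hv ∈ idealDirections ↔ v.2.1 = 0 := by
  obtain ⟨α, β, c⟩ := v
  simp only [idealDirections, dir, dirInf, Set.mem_union, Set.mem_range, Set.mem_singleton_iff,
    Projectivization.mk_eq_mk_iff', Prod.smul_mk, smul_eq_mul, Prod.mk.injEq]
  constructor
  · rintro (⟨t, a, hα, hβ, -⟩ | ⟨a, -, h, -⟩)
    · exact (mul_eq_zero.1 hβ).resolve_left (left_ne_zero_of_mul_eq_one hα)
    · simpa using h.symm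
  · rintro rfl
    by_cases hα : α = 0
    · exact Or.inr ⟨c, by simp [hα]⟩
    · exact Or.inl ⟨c / α, α⁻¹, by simp [hα, div_eq_inv_mul]⟩

theorem actOn_mem_idealDirections_iff (g : Heisenberg ℝ) (θ : Direction) :
    actOn g θ ∈ idealDirections ↔ θ ∈ idealDirections := by
  induction θ using Projectivization.ind with
  | h v hv =>
    rw [actOn, Projectivization.map_mk, mk_mem_idealDirections_iff, mk_mem_idealDirections_iff]
    rfl

theorem dir_injective : Function.Injective dir := by
  intro s t h
  obtain ⟨a, ha⟩ := (Projectivization.mk_eq_mk_iff' ℝ _ _ _ _).1 h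
  simp only [Prod.smul_mk, smul_eq_mul, mul_one, Prod.mk.injEq] at ha
  obtain ⟨rfl, -, hst⟩ := ha
  rwa [one_mul, eq_comm] at hst

theorem not_countable_idealDirections : ¬ idealDirections.Countable := by
  intro h
  have hpre := (h.mono Set.subset_union_left).preimage dir_injective
  rw [Set.preimage_range] at hpre
  exact Cardinal.not_countable_real hpre

theorem mem_expLine_mk {v : Alg} (hv : v ≠ 0) {g : Heisenberg ℝ} :
    g ∈ expLine (Projectivization.mk ℝ v hv) ↔ ∃ s : ℝ, exp (s • v) = g := by
  simp [expLine, Projectivization.submodule_mk, Submodule.mem_span_singleton]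

theorem one_mem_expLine (θ : Direction) : 1 ∈ expLine θ := ⟨0, θ.submodule.zero_mem, exp_zero⟩

theorem exists_forall_eq_one (m : RightInvariantMetric) {θ : Direction}
    (hθ : θ ∉ idealDirections) :
    ∃ ε > 0, ∀ γ : Heisenberg ℤ, γ.y = 0 → ∀ g ∈ expLine θ, m.d (ofInt γ) g < ε → γ = 1 := by
  induction θ using Projectivization.ind with
  | h v hv =>
  rw [mk_mem_idealDirections_iff] at hθ
  -- If `γ.y = 0`, then the factor `exp (s • v)` of `γ = h * exp (s • v)` is determined by `h.y`.
  let lift (h : Heisenberg ℝ) : Heisenberg ℝ := h * exp ((-h.y / v.2.1) • v)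
  have lift_continuous : Continuous lift := by fun_prop
  have lift_one : lift 1 = 1 := by simp [lift, exp_zero]
  have isolated : ∀ᶠ h in 𝓝 1, ∀ γ : Heisenberg ℤ, ofInt γ = lift h → γ = 1 :=
    (lift_continuous.tendsto' 1 1 lift_one).eventually eventually_forall_ofInt_eq_imp_eq_one
  obtain ⟨ε, hε, hlift⟩ := m.exists_forall_d_lt_imp isolated
  refine ⟨ε, hε, fun γ hγ g hg hd => hlift _ _ hd γ ?_⟩
  obtain ⟨s, rfl⟩ := (mem_expLine_mk hv).1 hg
  have hs : -(ofInt γ * (exp (s • v))⁻¹).y / v.2.1 = s := by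
    simp [exp, hγ, hθ]
  simp only [lift, hs, inv_mul_cancel_right]

end Directions

section Actions

variable {X : Type} [MeasurableSpace X] [MulAction (Heisenberg ℤ) X] {μ : Measure X}
  {m : RightInvariantMetric} {θ : Direction}

theorem RigidAlong.recurrentAlong [SigmaFinite μ] (h : RigidAlong m μ θ) :
    RecurrentAlong m μ θ := by
  obtain ⟨γ, hγ, hdist, hweak⟩ := h
  intro ε hε A hA hpos
  obtain ⟨B, hB, hBA, hBpos, hBfin⟩ := Measure.exists_subset_measure_lt_top hA hpos
  have hne : ∀ᶠ n in atTop, γ n ≠ 1 := hγ.eventually (eventually_cofinite_ne 1)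
  have hclose : ∀ᶠ n in atTop, ⨅ g : expLine θ, m.d (ofInt (γ n)) g < ε :=
    hdist.eventually_lt_const hε
  have hmeet : ∀ᶠ n in atTop, 0 < μ (B ∩ γ n • B) :=
    (hweak B hB hBfin).eventually_const_lt hBpos
  obtain ⟨n, hn_ne, hn_close, hn_meet⟩ := (hne.and (hclose.and hmeet)).exists
  have : Nonempty (expLine θ) := ⟨1, one_mem_expLine θ⟩
  obtain ⟨⟨g, hg⟩, hgε⟩ := exists_lt_of_ciInf_lt hn_close
  refine ⟨γ n, hn_ne, g, hg, hgε, hn_meet.trans_le (measure_mono ?_)⟩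
  exact Set.inter_subset_inter hBA (Set.smul_set_mono hBA)

theorem rigidAlong_of_tendsto {γ : ℕ → Heisenberg ℤ} (hγ : Tendsto γ atTop cofinite)
    {g : ℕ → Heisenberg ℝ} (hg : ∀ n, g n ∈ expLine θ)
    (hgγ : Tendsto (fun n => ofInt (γ n) * (g n)⁻¹) atTop (𝓝 1))
    (hweak : ∀ A : Set X, MeasurableSet A → μ A < ⊤ →
      Tendsto (fun n => μ (A ∩ γ n • A)) atTop (𝓝 (μ A))) : RigidAlong m μ θ :=
  ⟨γ, hγ, squeeze_zero (fun _ => Real.iInf_nonneg fun _ => m.d_nonneg _ _)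
    (fun n => ciInf_le ⟨0, Set.forall_mem_range.2 fun _ => m.d_nonneg _ _⟩
      (⟨g n, hg n⟩ : expLine θ)) (m.tendsto_d_zero hgγ), hweak⟩

theorem RecurrentAlong.mem_idealDirections (h : RecurrentAlong m μ θ) {A : Set X}
    (hA : MeasurableSet A) (hpos : 0 < μ A)
    (hy : ∀ γ : Heisenberg ℤ, (A ∩ γ • A).Nonempty → γ.y = 0) : θ ∈ idealDirections := by
  by_contra hθ
  obtain ⟨ε, hε, hone⟩ := exists_forall_eq_one m hθ
  obtain ⟨γ, hγ, g, hg, hd, hmeet⟩ := h ε hε A hA hpos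
  exact hγ (hone γ (hy γ (nonempty_of_measure_ne_zero hmeet.ne')) g hg hd)

end Actions

end Heisenberg

section Padic

variable {p : ℕ} [Fact p.Prime]

theorem tendsto_padicInt_pow_mul (k : ℕ → ℤ) :
    Tendsto (fun n => (p : ℤ_[p]) ^ n * k n) atTop (𝓝 0) := by
  refine squeeze_zero_norm (fun n => ?_)
    (tendsto_pow_atTop_nhds_zero_of_lt_one (norm_nonneg (p : ℤ_[p]))
      (PadicInt.norm_lt_one_iff_dvd _ |>.2 dvd_rfl))
  rw [norm_mul, norm_pow]
  exact mul_le_of_le_one_right (by positivity) (PadicInt.norm_le_one _)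

theorem exists_int_dist_padicInt_le (n : ℕ) (w : ℤ_[p]) :
    ∃ a : ℤ, (0 ≤ a ∧ a < (p ^ n : ℕ)) ∧ dist w a ≤ (p : ℝ) ^ (-n : ℤ) := by
  refine ⟨w.appr n, ⟨by positivity, by exact_mod_cast w.appr_lt n⟩, ?_⟩
  rw [dist_eq_norm, Int.cast_natCast]
  exact (PadicInt.norm_le_pow_iff_mem_span_pow _ n).2 (PadicInt.appr_spec n w)

theorem int_eq_of_dist_padicInt_le {n : ℕ} {a b : ℤ} {w : ℤ_[p]}
    (ha : 0 ≤ a ∧ a < (p ^ n : ℕ)) (hb : 0 ≤ b ∧ b < (p ^ n : ℕ))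
    (hwa : dist w a ≤ (p : ℝ) ^ (-n : ℤ)) (hwb : dist w b ≤ (p : ℝ) ^ (-n : ℤ)) : a = b := by
  have hab : ‖((a - b : ℤ) : ℤ_[p])‖ ≤ (p : ℝ) ^ (-n : ℤ) := by
    rw [Int.cast_sub, ← dist_eq_norm]
    exact (dist_triangle_max _ w _).trans (max_le (dist_comm w (a : ℤ_[p]) ▸ hwa) hwb)
  have hdvd : ((p ^ n : ℕ) : ℤ) ∣ a - b := by
    exact_mod_cast PadicInt.norm_int_le_pow_iff_dvd.1 hab
  exact sub_eq_zero.1 (Int.eq_zero_of_abs_lt_dvd hdvd (abs_lt.2 ⟨by omega, by omega⟩))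

end Padic

/-- The group of unitriangular matrices `(x, y, z)` with `x, z ∈ ℤₚ` and `y ∈ ℤ`, on which
`H₃(ℤ)` acts by left translation. -/
@[ext]
structure PadicHeisenberg (p : ℕ) [Fact p.Prime] where
  x : ℤ_[p]
  y : ℤ
  z : ℤ_[p]

namespace PadicHeisenberg

variable {p : ℕ} [Fact p.Prime]

section Group

noncomputable instance : Mul (PadicHeisenberg p) :=
  ⟨fun g h => ⟨g.x + h.x, g.y + h.y, g.z + h.z + g.x * h.y⟩⟩
noncomputable instance : One (PadicHeisenberg p) := ⟨⟨0, 0, 0⟩⟩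
noncomputable instance : Inv (PadicHeisenberg p) := ⟨fun g => ⟨-g.x, -g.y, -g.z + g.x * g.y⟩⟩

@[simp] theorem mul_x (g h : PadicHeisenberg p) : (g * h).x = g.x + h.x := rfl
@[simp] theorem mul_y (g h : PadicHeisenberg p) : (g * h).y = g.y + h.y := rfl
@[simp] theorem mul_z (g h : PadicHeisenberg p) : (g * h).z = g.z + h.z + g.x * h.y := rfl
@[simp] theorem one_x : (1 : PadicHeisenberg p).x = 0 := rfl
@[simp] theorem one_y : (1 : PadicHeisenberg p).y = 0 := rfl
@[simp] theorem one_z : (1 : PadicHeisenberg p).z = 0 := rfl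
@[simp] theorem inv_x (g : PadicHeisenberg p) : g⁻¹.x = -g.x := rfl
@[simp] theorem inv_y (g : PadicHeisenberg p) : g⁻¹.y = -g.y := rfl
@[simp] theorem inv_z (g : PadicHeisenberg p) : g⁻¹.z = -g.z + g.x * g.y := rfl

noncomputable instance : Group (PadicHeisenberg p) :=
  Group.ofLeftAxioms
    (by intro a b c; ext1 <;> simp <;> ring)
    (by intro a; ext1 <;> simp)
    (by intro a; ext1 <;> simp)

/-- The embedding of `H₃(ℤ)`, through which it acts. -/
noncomputable def ofHeisenberg : Heisenberg ℤ →* PadicHeisenberg p where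
  toFun g := ⟨g.x, g.y, g.z⟩
  map_one' := by ext1 <;> simp
  map_mul' g h := by ext1 <;> simp

@[simp] theorem ofHeisenberg_x (g : Heisenberg ℤ) :
    (ofHeisenberg g : PadicHeisenberg p).x = g.x := rfl
@[simp] theorem ofHeisenberg_y (g : Heisenberg ℤ) :
    (ofHeisenberg g : PadicHeisenberg p).y = g.y := rfl
@[simp] theorem ofHeisenberg_z (g : Heisenberg ℤ) :
    (ofHeisenberg g : PadicHeisenberg p).z = g.z := rfl

theorem ofHeisenberg_injective :
    Function.Injective (ofHeisenberg : Heisenberg ℤ → PadicHeisenberg p) := by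
  intro g h hgh
  simp only [PadicHeisenberg.ext_iff, ofHeisenberg_x, ofHeisenberg_y, ofHeisenberg_z,
    Int.cast_inj] at hgh
  exact Heisenberg.ext hgh.1 hgh.2.1 hgh.2.2

noncomputable instance : MulAction (Heisenberg ℤ) (PadicHeisenberg p) :=
  MulAction.compHom _ (ofHeisenberg (p := p))

theorem smul_eq (γ : Heisenberg ℤ) (g : PadicHeisenberg p) : γ • g = ofHeisenberg γ * g := rfl

end Group

section Topology

/-- The coordinates of an element. -/
def equivProd : PadicHeisenberg p ≃ ℤ_[p] × ℤ × ℤ_[p] where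
  toFun g := (g.x, g.y, g.z)
  invFun q := ⟨q.1, q.2.1, q.2.2⟩

noncomputable instance : MetricSpace (PadicHeisenberg p) :=
  MetricSpace.induced equivProd equivProd.injective inferInstance

theorem dist_eq_max (g h : PadicHeisenberg p) :
    dist g h = max (dist g.x h.x) (max (dist g.y h.y) (dist g.z h.z)) := rfl

/-- The homeomorphism given by the coordinates. -/
noncomputable def homeoProd : PadicHeisenberg p ≃ₜ ℤ_[p] × ℤ × ℤ_[p] :=
  equivProd.toHomeomorphOfIsInducing ⟨rfl⟩

instance : LocallyCompactSpace (PadicHeisenberg p) :=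
  homeoProd.isClosedEmbedding.locallyCompactSpace

instance : PolishSpace (PadicHeisenberg p) :=
  homeoProd.isClosedEmbedding.polishSpace

noncomputable instance : MeasurableSpace (PadicHeisenberg p) := borel _

instance : BorelSpace (PadicHeisenberg p) := ⟨rfl⟩

@[fun_prop]
theorem continuous_x : Continuous (x : PadicHeisenberg p → ℤ_[p]) :=
  continuous_fst.comp homeoProd.continuous

@[fun_prop]
theorem continuous_y : Continuous (y : PadicHeisenberg p → ℤ) :=
  (continuous_fst.comp continuous_snd).comp homeoProd.continuous

@[fun_prop]
theorem continuous_z : Continuous (z : PadicHeisenberg p → ℤ_[p]) :=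
  (continuous_snd.comp continuous_snd).comp homeoProd.continuous

@[fun_prop]
theorem continuous_mk {Y : Type*} [TopologicalSpace Y] {a : Y → ℤ_[p]} {b : Y → ℤ} {c : Y → ℤ_[p]}
    (ha : Continuous a) (hb : Continuous b) (hc : Continuous c) :
    Continuous (fun t => (⟨a t, b t, c t⟩ : PadicHeisenberg p)) :=
  homeoProd.symm.continuous.comp (ha.prodMk (hb.prodMk hc))

instance : IsTopologicalGroup (PadicHeisenberg p) where
  continuous_mul := by
    change Continuous fun q : PadicHeisenberg p × PadicHeisenberg p =>
      (⟨q.1.x + q.2.x, q.1.y + q.2.y, q.1.z + q.2.z + q.1.x * q.2.y⟩ : PadicHeisenberg p)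
    fun_prop
  continuous_inv := by
    change Continuous fun g : PadicHeisenberg p =>
      (⟨-g.x, -g.y, -g.z + g.x * g.y⟩ : PadicHeisenberg p)
    fun_prop

instance : NoncompactSpace (PadicHeisenberg p) := by
  refine not_compactSpace_iff.1 fun _ => noncompact_univ ℤ ?_
  have hy : Function.Surjective (y : PadicHeisenberg p → ℤ) := fun n => ⟨⟨0, n, 0⟩, rfl⟩
  exact hy.range_eq ▸ isCompact_range continuous_y

instance : ContinuousConstSMul (Heisenberg ℤ) (PadicHeisenberg p) :=
  ⟨fun γ => continuous_const_mul (ofHeisenberg γ)⟩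

instance : MeasurableConstSMul (Heisenberg ℤ) (PadicHeisenberg p) :=
  ⟨fun γ => (continuous_const_smul γ).measurable⟩

theorem tendsto_ofHeisenberg_pow_mul (k j : ℕ → ℤ) :
    Tendsto (fun n => (ofHeisenberg ⟨p ^ n * k n, 0, p ^ n * j n⟩ : PadicHeisenberg p)) atTop
      (𝓝 1) := by
  have hmk : Tendsto (fun q : ℤ_[p] × ℤ_[p] => (⟨q.1, 0, q.2⟩ : PadicHeisenberg p)) (𝓝 (0, 0))
      (𝓝 1) := Continuous.tendsto' (by fun_prop) _ _ rfl
  refine (hmk.comp ((tendsto_padicInt_pow_mul k).prodMk_nhds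
    (tendsto_padicInt_pow_mul j))).congr fun n => ?_
  ext1 <;> simp

end Topology

section Action

open Heisenberg

variable (μ : Measure (PadicHeisenberg p))

instance [μ.IsMulLeftInvariant] : SMulInvariantMeasure (Heisenberg ℤ) (PadicHeisenberg p) μ :=
  ⟨fun γ s _ => measure_preimage_mul μ (ofHeisenberg γ) s⟩

theorem freeAction : FreeAction (Heisenberg ℤ) μ := by
  refine .of_forall fun g γ hγ => ofHeisenberg_injective (p := p) ?_
  rw [smul_eq, mul_eq_right] at hγ
  rw [hγ, map_one]

variable [μ.IsHaarMeasure] (m : RightInvariantMetric) {θ : Direction}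

theorem rigidAlong_of_tendsto_mul_inv {j k : ℕ → ℤ}
    (hγ : Tendsto (fun n => (⟨p ^ n * k n, 0, p ^ n * j n⟩ : Heisenberg ℤ)) atTop cofinite)
    {g : ℕ → Heisenberg ℝ} (hg : ∀ n, g n ∈ expLine θ)
    (hgγ : Tendsto (fun n => ofInt ⟨p ^ n * k n, 0, p ^ n * j n⟩ * (g n)⁻¹) atTop (𝓝 1)) :
    RigidAlong m μ θ :=
  rigidAlong_of_tendsto hγ hg hgγ fun _ hA hfin =>
    tendsto_measure_inter_smul μ (tendsto_ofHeisenberg_pow_mul k j) hA hfin.ne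

theorem tendsto_cofinite_of_pow_mul {f : Heisenberg ℤ → ℤ} {γ : ℕ → Heisenberg ℤ} {k : ℕ → ℤ}
    (hk : ∀ n, 0 < k n) (hf : ∀ n, f (γ n) = p ^ n * k n) : Tendsto γ atTop cofinite := by
  have hp : (1 : ℤ) < p := by exact_mod_cast (Fact.out : p.Prime).one_lt
  have hfγ : Tendsto (f ∘ γ) atTop atTop :=
    tendsto_atTop_mono (fun n => (le_mul_of_one_le_right (by positivity) (hk n)).trans_eq
      (hf n).symm) (tendsto_pow_atTop_atTop_of_one_lt hp)
  exact (hfγ.mono_right atTop_le_cofinite).of_tendsto_comp (comap_cofinite_le f)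

theorem rigidAlong_dirInf : RigidAlong m μ dirInf := by
  refine rigidAlong_of_tendsto_mul_inv μ m (j := 1) (k := 0)
    (g := fun n => ofInt ⟨p ^ n * 0, 0, p ^ n * 1⟩)
    (tendsto_cofinite_of_pow_mul (p := p) (f := Heisenberg.z) (k := 1) (by simp) (by simp))
    (fun n => (mem_expLine_mk _).2 ⟨p ^ n, ?_⟩) (by simp [tendsto_const_nhds])
  ext <;> simp [exp]

theorem rigidAlong_dir (t : ℝ) : RigidAlong m μ (dir t) := by
  obtain ⟨j, k, hk, hjk⟩ := exists_int_seq_tendsto_natCast_mul_sub t (fun n => p ^ n)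
  refine rigidAlong_of_tendsto_mul_inv μ m (j := j) (k := k)
    (g := fun n => exp ((p ^ n * k n : ℝ) • (1, 0, t)))
    (tendsto_cofinite_of_pow_mul (f := Heisenberg.x) hk fun _ => rfl)
    (fun n => (mem_expLine_mk _).2 ⟨_, rfl⟩) ?_
  have hmk : Tendsto (fun s : ℝ => (⟨0, 0, s⟩ : Heisenberg ℝ)) (𝓝 0) (𝓝 1) :=
    Continuous.tendsto' (by fun_prop) _ _ rfl
  refine (hmk.comp hjk).congr fun n => ?_
  ext
  · simp [exp]
  · simp [exp]
  · simp [exp]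
    ring

theorem rigidAlong_of_mem_idealDirections (hθ : θ ∈ idealDirections) : RigidAlong m μ θ := by
  rcases hθ with ⟨t, rfl⟩ | rfl
  · exact rigidAlong_dir μ m t
  · exact rigidAlong_dirInf μ m

theorem mem_idealDirections_of_recurrentAlong (hθ : RecurrentAlong m μ θ) :
    θ ∈ idealDirections := by
  have hopen : IsOpen {g : PadicHeisenberg p | g.y = 0} :=
    (isOpen_discrete {(0 : ℤ)}).preimage continuous_y
  refine hθ.mem_idealDirections hopen.measurableSet (hopen.measure_pos μ ⟨1, rfl⟩) ?_
  rintro γ ⟨_, hγg, g, hg, rfl⟩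
  exact (add_eq_right (b := g.y)).1 (hγg.trans hg.symm)

theorem recurrentAlong_iff : RecurrentAlong m μ θ ↔ θ ∈ idealDirections :=
  ⟨mem_idealDirections_of_recurrentAlong μ m,
    fun hθ => (rigidAlong_of_mem_idealDirections μ m hθ).recurrentAlong⟩

theorem rigidAlong_iff : RigidAlong m μ θ ↔ θ ∈ idealDirections :=
  ⟨fun hθ => mem_idealDirections_of_recurrentAlong μ m hθ.recurrentAlong,
    rigidAlong_of_mem_idealDirections μ m⟩

theorem evenlyRecurrentAlong_iff : EvenlyRecurrentAlong m μ θ ↔ θ ∈ idealDirections := by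
  simp only [EvenlyRecurrentAlong, recurrentAlong_iff, actOn_mem_idealDirections_iff, forall_const]

theorem evenlyRigidAlong_iff : EvenlyRigidAlong m μ θ ↔ θ ∈ idealDirections := by
  simp only [EvenlyRigidAlong, rigidAlong_iff, actOn_mem_idealDirections_iff, forall_const]

end Action

section Tower

open Heisenberg

/-- The base `pⁿℤₚ × {0} × pⁿℤₚ` of the `n`-th tower. -/
def base (p : ℕ) [Fact p.Prime] (n : ℕ) : Set (PadicHeisenberg p) :=
  {g | dist g.x 0 ≤ (p : ℝ) ^ (-n : ℤ) ∧ g.y = 0 ∧ dist g.z 0 ≤ (p : ℝ) ^ (-n : ℤ)}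

theorem isClosed_base (n : ℕ) : IsClosed (base p n) :=
  (isClosed_le (continuous_x.dist continuous_const) continuous_const).inter
    ((isClosed_eq continuous_y continuous_const).inter
      (isClosed_le (continuous_z.dist continuous_const) continuous_const))

theorem isCompact_base (n : ℕ) : IsCompact (base p n) := by
  have hslice : IsCompact (homeoProd ⁻¹' (Set.univ ×ˢ {0} ×ˢ Set.univ : Set (ℤ_[p] × ℤ × ℤ_[p]))) :=
    homeoProd.isCompact_preimage.2 (isCompact_univ.prod (isCompact_singleton.prod isCompact_univ))
  exact hslice.of_isClosed_subset (isClosed_base n) fun g hg => ⟨trivial, hg.2.1, trivial⟩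

theorem mem_smul_base {n : ℕ} {f : Heisenberg ℤ} {g : PadicHeisenberg p} :
    g ∈ f • base p n ↔
      dist g.x f.x ≤ (p : ℝ) ^ (-n : ℤ) ∧ g.y = f.y ∧ dist g.z f.z ≤ (p : ℝ) ^ (-n : ℤ) := by
  simp only [dist_eq_norm]
  constructor
  · rintro ⟨b, ⟨hx, hy, hz⟩, rfl⟩
    rw [dist_zero_right] at hx hz
    exact ⟨by simpa [smul_eq] using hx, by simp [smul_eq, hy], by simpa [smul_eq, hy] using hz⟩
  · rintro ⟨hx, hy, hz⟩
    rw [← dist_zero_right] at hx hz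
    exact ⟨⟨g.x - f.x, 0, g.z - f.z⟩, ⟨hx, rfl, hz⟩, by ext1 <;> simp [smul_eq, hy]⟩

theorem pairwiseDisjoint_smul_base (n b : ℕ) :
    (intervalBox (p ^ n) b : Set (Heisenberg ℤ)).PairwiseDisjoint (fun f => f • base p n) := by
  intro f hf f' hf' hne
  refine Set.disjoint_left.2 fun g hg hg' => hne ?_
  obtain ⟨hfx, -, hfz⟩ := mem_intervalBox.1 hf
  obtain ⟨hfx', -, hfz'⟩ := mem_intervalBox.1 hf'
  obtain ⟨hx, hy, hz⟩ := mem_smul_base.1 hg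
  obtain ⟨hx', hy', hz'⟩ := mem_smul_base.1 hg'
  exact Heisenberg.ext (int_eq_of_dist_padicInt_le hfx hfx' hx hx') (hy.symm.trans hy')
    (int_eq_of_dist_padicInt_le hfz hfz' hz hz')

theorem exists_mem_smul_base (n : ℕ) {b : ℕ} {g : PadicHeisenberg p} (hg : |g.y| ≤ b) :
    ∃ f ∈ intervalBox (p ^ n) b, g ∈ f • base p n := by
  obtain ⟨a, ha, hxa⟩ := exists_int_dist_padicInt_le n g.x
  obtain ⟨c, hc, hzc⟩ := exists_int_dist_padicInt_le n g.z
  exact ⟨⟨a, g.y, c⟩, mem_intervalBox.2 ⟨ha, hg, hc⟩, mem_smul_base.2 ⟨hxa, rfl, hzc⟩⟩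

theorem dist_le_of_mem_smul_base {n : ℕ} {f : Heisenberg ℤ} {g h : PadicHeisenberg p}
    (hg : g ∈ f • base p n) (hh : h ∈ f • base p n) : dist g h ≤ (p : ℝ) ^ (-n : ℤ) := by
  obtain ⟨hgx, hgy, hgz⟩ := mem_smul_base.1 hg
  obtain ⟨hhx, hhy, hhz⟩ := mem_smul_base.1 hh
  rw [dist_comm] at hhx hhz
  rw [dist_eq_max, hgy, hhy, dist_self]
  exact max_le ((dist_triangle_max _ _ _).trans (max_le hgx hhx))
    (max_le (by positivity) ((dist_triangle_max _ _ _).trans (max_le hgz hhz)))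

theorem eventually_subset_biUnion_smul_base {K : Set (PadicHeisenberg p)} (hK : IsCompact K) :
    ∀ᶠ n : ℕ in atTop, K ⊆ ⋃ f ∈ intervalBox (p ^ n) n, f • base p n := by
  obtain ⟨C, hC⟩ := (hK.image (f := fun g => |g.y|) (by fun_prop)).bddAbove
  filter_upwards [eventually_ge_atTop C.toNat] with n hn g hg
  have hgC : |g.y| ≤ C := hC ⟨g, hg, rfl⟩
  exact Set.mem_iUnion₂.2 ((exists_mem_smul_base n (by omega)).imp fun _ h => ⟨h.1, h.2⟩)

theorem rankOneAction (μ : Measure (PadicHeisenberg p)) [IsLocallyFiniteMeasure μ] :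
    RankOneAction (Heisenberg ℤ) μ := by
  have hp : 1 < (p : ℝ) := by exact_mod_cast (Fact.out : p.Prime).one_lt
  refine ⟨fun n => intervalBox (p ^ n) n, base p, isFoelner_intervalBox ?_ tendsto_id ?_,
    fun n => ⟨(isClosed_base n).measurableSet, (isCompact_base n).measure_lt_top⟩,
    fun n => pairwiseDisjoint_smul_base n n, fun A hA hfin => ?_⟩
  · exact tendsto_pow_atTop_atTop_of_one_lt (Fact.out : p.Prime).one_lt
  · simpa using tendsto_pow_const_div_const_pow_of_one_lt 1 hp
  · have hr : Tendsto (fun n : ℕ => (p : ℝ) ^ (-n : ℤ)) atTop (𝓝 0) := by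
      simpa [Function.comp_def] using
        tendsto_inv_atTop_zero.comp (tendsto_pow_atTop_atTop_of_one_lt hp)
    exact exists_tendsto_measure_symmDiff_biUnion (fun K U hK hU hKU =>
      eventually_exists_subset_biUnion_subset hr
        (fun _ _ _ _ hg _ hh => dist_le_of_mem_smul_base hg hh) hK hU hKU
        (eventually_subset_biUnion_smul_base hK)) hA hfin.ne

end Tower

end PadicHeisenberg

theorem theorem6p3 :
    ∃ (X : Type) (_ : MeasurableSpace X) (_ : StandardBorelSpace X)
      (_ : MulAction (Heisenberg ℤ) X) (_ : MeasurableConstSMul (Heisenberg ℤ) X)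
      (μ : Measure X) (_ : SigmaFinite μ) (_ : SMulInvariantMeasure (Heisenberg ℤ) X μ),
      μ Set.univ = ⊤ ∧
      FreeAction (Heisenberg ℤ) μ ∧
      RankOneAction (Heisenberg ℤ) μ ∧
      (∀ m : Heisenberg.RightInvariantMetric,
        {θ | Heisenberg.RecurrentAlong m μ θ} =
          Set.range Heisenberg.dir ∪ {Heisenberg.dirInf} ∧
        {θ | Heisenberg.RigidAlong m μ θ} =
          Set.range Heisenberg.dir ∪ {Heisenberg.dirInf} ∧
        {θ | Heisenberg.EvenlyRecurrentAlong m μ θ} =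
          Set.range Heisenberg.dir ∪ {Heisenberg.dirInf} ∧
        {θ | Heisenberg.EvenlyRigidAlong m μ θ} =
          Set.range Heisenberg.dir ∪ {Heisenberg.dirInf}) ∧
      ¬ (Set.range Heisenberg.dir ∪ {Heisenberg.dirInf}).Countable := by
  let μ : Measure (PadicHeisenberg 2) := Measure.haar
  exact ⟨PadicHeisenberg 2, inferInstance, inferInstance, inferInstance, inferInstance, μ,
    inferInstance, inferInstance, measure_univ_of_isMulLeftInvariant μ,
    PadicHeisenberg.freeAction μ, PadicHeisenberg.rankOneAction μ,
    fun m => ⟨Set.ext fun _ => PadicHeisenberg.recurrentAlong_iff μ m,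
      Set.ext fun _ => PadicHeisenberg.rigidAlong_iff μ m,
      Set.ext fun _ => PadicHeisenberg.evenlyRecurrentAlong_iff μ m,
      Set.ext fun _ => PadicHeisenberg.evenlyRigidAlong_iff μ m⟩,
    Heisenberg.not_countable_idealDirections⟩
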